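/- Let $\rho,\sigma$ be quantum states (positive semidefinite operators of unit trace) on a finite-dimensional complex Hilbert space. For a hermitian operator $X$ let $\operatorname{Tr}(X)_+$ be the sum of its positive eigenvalues, and for $\gamma\ge 1$ put $E_\gamma(\rho\|\sigma)=\operatorname{Tr}(\rho-\gamma\sigma)_+$. For $\alpha>1$ let $f_\alpha(x)=\frac{x^\alpha-1}{\alpha-1}$ and define the Hellinger and Rényi divergences $$H_\alpha(\rho\|\sigma)=\int_1^\infty\Big(f_\alpha''(\gamma)\,E_\gamma(\rho\|\sigma)+\gamma^{-3}f_\alpha''(\gamma^{-1})\,E_\gamma(\sigma\|\rho)\Big)\,d\gamma\in[0,\infty],$$ $$D_\alpha(\rho\|\sigma)=\frac1{\alpha-1}\log\big(1+(\alpha-1)H_\alpha(\rho\|\sigma)\big).$$ Let $$\widetilde Q_\alpha(\rho\|\sigma)=\operatorname{Tr}\Big[\big(\sigma^{\frac{1-\alpha}{2\alpha}}\rho\,\sigma^{\frac{1-\alpha}{2\alpha}}\big)^\alpha\Big]$$ if the support of $\rho$ is contained in the support of $\sigma$ (negative powers of $\sigma$ being taken on the support of $\sigma$ and zero on its kernel),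 and $\widetilde Q_\alpha(\rho\|\sigma)=+\infty$ otherwise. Define the sandwiched Hellinger and Rényi divergences $$\widetilde H_\alpha(\rho\|\sigma)=\frac1{1-\alpha}\big(1-\widetilde Q_\alpha(\rho\|\sigma)\big),\qquad \widetilde D_\alpha(\rho\|\sigma)=\frac1{\alpha-1}\log\widetilde Q_\alpha(\rho\|\sigma).$$ Then for every integer $\alpha\ge2$, $$H_\alpha(\rho\|\sigma)\le\widetilde H_\alpha(\rho\|\sigma)\qquad\text{and}\qquad D_\alpha(\rho\|\sigma)\le\widetilde D_\alpha(\rho\|\sigma).$$ (All quantities take values in $(-\infty,+\infty]$, and $\log$ is the natural logarithm with $\log(+\infty)=+\infty$.) -/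

import Mathlib

open MeasureTheory Matrix
open scoped ComplexOrder

noncomputable section

namespace QuantumDivergence

variable {n : Type*} [Fintype n] [DecidableEq n]

/-- A quantum state on the Hilbert space `ℂⁿ`: a positive operator with unit trace. -/
def IsState (ρ : Matrix n n ℂ) : Prop :=
  ρ.PosSemidef ∧ ρ.trace = 1

/-- `ρ ≪ σ`: the support of `ρ` is contained in the support of `σ`. The support of a hermitian
operator is its range. -/
def SuppLE (ρ σ : Matrix n n ℂ) : Prop :=
  LinearMap.range ρ.mulVecLin ≤ LinearMap.range σ.mulVecLin

/-- `Tr (X)₊`, the sum of the positive eigenvalues of the hermitian operator `X`: the trace of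
the positive part of `X`. -/
def tracePosPart (X : Matrix n n ℂ) : ℝ :=
  (cfc (fun x : ℝ => max x 0) X).trace.re

/-- The quantum hockey-stick divergence `E_γ(ρ‖σ) = Tr (ρ - γ σ)₊`. -/
def hockeyStick (γ : ℝ) (ρ σ : Matrix n n ℂ) : ℝ :=
  tracePosPart (ρ - (γ : ℂ) • σ)

/-- The quantum `f`-divergence
`D_f(ρ‖σ) = ∫_1^∞ (f''(γ) E_γ(ρ‖σ) + γ⁻³ f''(γ⁻¹) E_γ(σ‖ρ)) dγ`
for convex, twice differentiable `f : (0, ∞) → ℝ` with `f 1 = 0`. The integrand is nonnegative,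
so the integral is a well-defined element of `[0, ∞]`. -/
def fDivergence (f : ℝ → ℝ) (ρ σ : Matrix n n ℂ) : ENNReal :=
  ∫⁻ γ in Set.Ioi (1 : ℝ), ENNReal.ofReal
    (deriv (deriv f) γ * hockeyStick γ ρ σ
      + (γ ^ 3)⁻¹ * deriv (deriv f) γ⁻¹ * hockeyStick γ σ ρ)

/-- `f_α(x) = (x^α - 1) / (α - 1)`. -/
def hellingerFun (α : ℝ) (x : ℝ) : ℝ :=
  (x ^ α - 1) / (α - 1)

/-- The Hellinger divergence `H_α(ρ‖σ) = D_{f_α}(ρ‖σ)` (for `α > 0`, `α ≠ 1`). -/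
def hellinger (α : ℝ) (ρ σ : Matrix n n ℂ) : ENNReal :=
  fDivergence (hellingerFun α) ρ σ

/-- The Rényi divergence `D_α(ρ‖σ) = 1/(α-1) * log (1 + (α-1) H_α(ρ‖σ))`
(for `α > 0`, `α ≠ 1`), with values in `[-∞, ∞]`; `log` is the natural logarithm, `log ∞ = ∞`. -/
def renyi (α : ℝ) (ρ σ : Matrix n n ℂ) : EReal :=
  ((1 / (α - 1) : ℝ) : EReal) *
    ENNReal.log (1 + ((α - 1 : ℝ) : EReal) * (hellinger α ρ σ : EReal)).toENNReal

/-- The power `X^p` of a positive operator. A negative power is a power of the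
generalized (Penrose) inverse, since `0 ^ p = 0` for `p ≠ 0`. -/
def opPow (X : Matrix n n ℂ) (p : ℝ) : Matrix n n ℂ :=
  cfc (fun x : ℝ => x ^ p) X

/-- `Tr [(σ^{(1-α)/(2α)} ρ σ^{(1-α)/(2α)})^α]`, with the usual convention that it is `+∞` if
`α > 1` and the support of `ρ` is not contained in the support of `σ`. -/
def sandwichedTrace (α : ℝ) (ρ σ : Matrix n n ℂ) : ENNReal :=
  open Classical in
  if 1 < α ∧ ¬ SuppLE ρ σ then ⊤
  else ENNReal.ofReal
    (opPow (opPow σ ((1 - α) / (2 * α)) * ρ * opPow σ ((1 - α) / (2 * α))) α).trace.re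

/-- The sandwiched Hellinger divergence
`H̃_α(ρ‖σ) = 1/(1-α) * (1 - Tr [(σ^{(1-α)/(2α)} ρ σ^{(1-α)/(2α)})^α])`. -/
def sandwichedHellinger (α : ℝ) (ρ σ : Matrix n n ℂ) : EReal :=
  ((1 / (1 - α) : ℝ) : EReal) * (1 - (sandwichedTrace α ρ σ : EReal))

/-- The sandwiched Rényi divergence
`D̃_α(ρ‖σ) = 1/(α-1) * log Tr [(σ^{(1-α)/(2α)} ρ σ^{(1-α)/(2α)})^α]`. -/
def sandwichedRenyi (α : ℝ) (ρ σ : Matrix n n ℂ) : EReal :=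
  ((1 / (α - 1) : ℝ) : EReal) * ENNReal.log (sandwichedTrace α ρ σ)

end QuantumDivergence

end

noncomputable section

namespace QuantumDivergence

variable {n : Type*} [Fintype n] [DecidableEq n]

/-! Write `E_s` for `hockeyStick s ρ σ`, now for all `s > 0`. Since `s E_{1/s}(σ‖ρ) = E_s(ρ‖σ) - 1 +
s` for states (`hockeyStick_swap`), substituting `s = 1/γ` in the second half of the integral gives
`1 + (α-1) H_α = ∫₀^∞ α(α-1) s^(α-2) E_s ds` (`one_add_mul_hellinger`).

Let `N` count positive eigenvalues. The layer-cake formula gives `E_s = s ∫₀^∞ N(ρ - s(σ+t)) dt`. By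
Sylvester's law the count is `N(M_t - s)` with `M_t = (σ+t)^(-1/2) ρ (σ+t)^(-1/2)`. Integrating over
`s` first turns the counts into a trace of a power, so `1 + (α-1) H_α = (α-1) ∫₀^∞ Tr M_t^α dt`
(`lintegral_pow_mul_hockeyStick`).

Finally let `R = σ^p ρ σ^p` with `p = (1-α)/(2α)`. Araki–Lieb–Thirring (`trace_mul_pow_le`, by
Hadamard's three lines theorem) bounds `Tr M_t^α` by `Tr R^α σ^(α-1) (σ+t)^(-α)`. Since `(α-1) ∫₀^∞
x^(α-1) (x+t)^(-α) dt ≤ 1`, the total is at most `Tr R^α`, the sandwiched trace. -/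

/-! ### Complex powers of positive matrices -/

/-- `x ^ z` for `x > 0`, extended by `0` to `x ≤ 0`; entire in `z`. -/
def suppPow (x : ℝ) (z : ℂ) : ℂ :=
  if 0 < x then Complex.exp (z * Real.log x) else 0

lemma suppPow_add (x : ℝ) (z w : ℂ) : suppPow x (z + w) = suppPow x z * suppPow x w := by
  unfold suppPow
  split_ifs
  · rw [add_mul, Complex.exp_add]
  · simp

lemma star_suppPow (x : ℝ) (z : ℂ) : star (suppPow x z) = suppPow x (star z) := by
  unfold suppPow
  split_ifs
  · simp [← Complex.exp_conj]
  · simp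

lemma suppPow_one {x : ℝ} (hx : 0 ≤ x) : suppPow x 1 = x := by
  unfold suppPow
  split_ifs with h
  · rw [one_mul, ← Complex.ofReal_exp, Real.exp_log h]
  · simp [le_antisymm (not_lt.mp h) hx]

lemma differentiable_suppPow (x : ℝ) : Differentiable ℂ (suppPow x) := by
  unfold suppPow
  split_ifs <;> fun_prop

/-- The power `A ^ z` of a positive matrix on its support, and `0` on its kernel. -/
def matPow {A : Matrix n n ℂ} (hA : A.IsHermitian) (z : ℂ) : Matrix n n ℂ :=
  (hA.eigenvectorUnitary : Matrix n n ℂ) * diagonal (fun i => suppPow (hA.eigenvalues i) z) *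
    star (hA.eigenvectorUnitary : Matrix n n ℂ)

section matPow

variable {A : Matrix n n ℂ} (hA : A.IsHermitian)

lemma eigenvectorUnitary_conj_mul (f g : n → ℂ) :
    ((hA.eigenvectorUnitary : Matrix n n ℂ) * diagonal f *
      star (hA.eigenvectorUnitary : Matrix n n ℂ)) *
    ((hA.eigenvectorUnitary : Matrix n n ℂ) * diagonal g *
      star (hA.eigenvectorUnitary : Matrix n n ℂ)) =
    (hA.eigenvectorUnitary : Matrix n n ℂ) * diagonal (fun i => f i * g i) *
      star (hA.eigenvectorUnitary : Matrix n n ℂ) := by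
  have h : star (hA.eigenvectorUnitary : Matrix n n ℂ) *
      (hA.eigenvectorUnitary : Matrix n n ℂ) = 1 := Unitary.coe_star_mul_self _
  rw [← diagonal_mul_diagonal]
  simp only [Matrix.mul_assoc]
  rw [← Matrix.mul_assoc (star _) (hA.eigenvectorUnitary : Matrix n n ℂ), h, Matrix.one_mul]

lemma matPow_mul (z w : ℂ) : matPow hA z * matPow hA w = matPow hA (z + w) := by
  unfold matPow
  rw [eigenvectorUnitary_conj_mul]
  simp only [suppPow_add]

lemma conjTranspose_matPow (z : ℂ) : (matPow hA z)ᴴ = matPow hA (star z) := by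
  unfold matPow
  simp only [conjTranspose_mul, star_eq_conjTranspose, conjTranspose_conjTranspose,
    diagonal_conjTranspose, Matrix.mul_assoc]
  congr 3
  ext i
  exact star_suppPow _ _

lemma matPow_one (hP : A.PosSemidef) : matPow hA 1 = A := by
  conv_rhs => rw [hA.spectral_theorem, Unitary.conjStarAlgAut_apply]
  unfold matPow
  congr 3
  ext i
  exact suppPow_one (hP.eigenvalues_nonneg i)

/-- Exponent `0` is excluded: `matPow hA 0` is the support projection, not the identity. -/
lemma matPow_natCast (hP : A.PosSemidef) {m : ℕ} (hm : m ≠ 0) : matPow hA m = A ^ m := by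
  induction m with
  | zero => exact absurd rfl hm
  | succ m ih =>
    rcases Nat.eq_zero_or_pos m with rfl | h
    · simp [matPow_one hA hP]
    · rw [Nat.cast_succ, ← matPow_mul, ih h.ne', matPow_one hA hP, pow_succ]

lemma differentiable_matPow (i j : n) : Differentiable ℂ fun z => matPow hA z i j := by
  have : ∀ l, Differentiable ℂ (suppPow (hA.eigenvalues l)) :=
    fun l => differentiable_suppPow _
  unfold matPow
  simp only [Matrix.mul_apply, diagonal_apply]
  refine Differentiable.fun_sum fun l _ => (Differentiable.fun_sum fun k _ => ?_).mul_const _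
  by_cases h : k = l
  · subst h; simpa using (this k).const_mul _
  · simp [h]

end matPow

/-! ### Trace inequalities -/

omit [DecidableEq n] in
lemma trace_conjTranspose_mul_self (X : Matrix n n ℂ) :
    (Xᴴ * X).trace = ((∑ i, ∑ j, ‖X i j‖ ^ 2 : ℝ) : ℂ) := by
  simp only [trace, diag, Matrix.mul_apply, conjTranspose_apply]
  push_cast
  rw [Finset.sum_comm]
  refine Finset.sum_congr rfl fun i _ => Finset.sum_congr rfl fun j _ => ?_
  rw [Complex.star_def, Complex.conj_mul']

omit [DecidableEq n] in
lemma trace_conjTranspose_mul_self_re_nonneg (X : Matrix n n ℂ) : 0 ≤ (Xᴴ * X).trace.re := by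
  rw [trace_conjTranspose_mul_self, Complex.ofReal_re]
  positivity

-- Cauchy–Schwarz for the Hilbert–Schmidt inner product.
omit [DecidableEq n] in
lemma norm_trace_mul_le (X Y : Matrix n n ℂ) :
    ‖(X * Y).trace‖ ≤ √ ((X * Xᴴ).trace.re) * √ ((Yᴴ * Y).trace.re) := by
  rw [trace_mul_comm X Xᴴ, trace_conjTranspose_mul_self, trace_conjTranspose_mul_self,
    Complex.ofReal_re, Complex.ofReal_re, Finset.sum_comm (f := fun i j => ‖Y i j‖ ^ 2)]
  simp only [trace, diag, Matrix.mul_apply, ← Finset.sum_product']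
  refine (norm_sum_le _ _).trans ?_
  simp only [norm_mul]
  exact Real.sum_mul_le_sqrt_mul_sqrt _ _ _

/-- The difference of the two sides is the squared Hilbert–Schmidt norm of `(1 - P) * B`. -/
lemma trace_conj_projection_le {P : Matrix n n ℂ} (hP : Pᴴ = P) (hPP : P * P = P)
    (B : Matrix n n ℂ) : (Bᴴ * P * B).trace.re ≤ (Bᴴ * B).trace.re := by
  have h := trace_conjTranspose_mul_self_re_nonneg ((1 - P) * B)
  have e : ((1 - P) * B)ᴴ * ((1 - P) * B) = Bᴴ * B - Bᴴ * P * B := by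
    rw [conjTranspose_mul, conjTranspose_sub, conjTranspose_one, hP]
    have : Bᴴ * (1 - P) * ((1 - P) * B) = Bᴴ * B - Bᴴ * P * B - Bᴴ * P * B + Bᴴ * (P * P) * B := by
      noncomm_ring
    rw [this, hPP]; noncomm_ring
  rw [e, trace_sub, Complex.sub_re] at h
  linarith

lemma trace_mul_pow_comm (A B : Matrix n n ℂ) (k : ℕ) :
    ((A * B) ^ k).trace = ((B * A) ^ k).trace := by
  cases k with
  | zero => simp
  | succ k =>
    have : ∀ m : ℕ, (A * B) ^ m * A = A * (B * A) ^ m := fun m => by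
      induction m with
      | zero => simp
      | succ m ih => rw [pow_succ', mul_assoc, ih, pow_succ']; simp only [mul_assoc]
    rw [pow_succ, ← mul_assoc, this, mul_assoc, trace_mul_comm, mul_assoc, ← pow_succ]

omit [DecidableEq n] in
lemma differentiable_mul_apply {A B : ℂ → Matrix n n ℂ}
    (hA : ∀ i j, Differentiable ℂ fun z => A z i j)
    (hB : ∀ i j, Differentiable ℂ fun z => B z i j) (i j : n) :
    Differentiable ℂ fun z => (A z * B z) i j := by
  simp only [Matrix.mul_apply]
  exact Differentiable.fun_sum fun l _ => (hA i l).mul (hB l j)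

omit [DecidableEq n] in
lemma differentiable_trace {A : ℂ → Matrix n n ℂ}
    (hA : ∀ i j, Differentiable ℂ fun z => A z i j) : Differentiable ℂ fun z => (A z).trace := by
  simp only [trace, diag]
  exact Differentiable.fun_sum fun l _ => hA l l

/-- Cancelling powers of `T` extracts the trace inequality from the three lines estimate, in which
`T` occurs on both sides. -/
lemma le_of_le_rpow_interp {T G k : ℝ} (T0 : 0 ≤ T) (hG0 : 0 ≤ G) (hk : 0 < k)
    (h : T ≤ T ^ (1 - 1 / k) * (√ G * √ T) ^ (1 / k)) : T ≤ G := by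
  rcases T0.eq_or_lt with h0 | hpos
  · rwa [← h0]
  have hpow : T ^ (1 / k) ≤ (√ G * √ T) ^ (1 / k) := by
    have hsplit : T ^ (1 - 1 / k) * T ^ (1 / k) = T := by
      rw [← Real.rpow_add hpos, sub_add_cancel, Real.rpow_one]
    exact le_of_mul_le_mul_left (hsplit.trans_le h) (Real.rpow_pos_of_pos hpos _)
  have hle : T ≤ √ G * √ T :=
    (Real.rpow_le_rpow_iff T0 (by positivity) (by positivity)).mp hpow
  have h4 : √ T * √ T ≤ √ G * √ T := by rwa [Real.mul_self_sqrt T0]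
  exact (Real.sqrt_le_sqrt_iff hG0).mp (le_of_mul_le_mul_right h4 (Real.sqrt_pos.mpr hpos))

/-- The **Araki–Lieb–Thirring inequality** for integer powers. -/
theorem trace_mul_pow_le {R C : Matrix n n ℂ} (hR : R.PosSemidef) (hC : C.PosSemidef)
    {k : ℕ} (hk : 1 ≤ k) : ((R * C) ^ k).trace.re ≤ (R ^ k * C ^ k).trace.re := by
  have hkr : (0 : ℝ) < k := by exact_mod_cast hk
  set pR := matPow hR.1
  set pC := matPow hC.1
  have mR : ∀ z w, pR z * pR w = pR (z + w) := matPow_mul _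
  have mC : ∀ z w, pC z * pC w = pC (z + w) := matPow_mul _
  have cR : ∀ z, (pR z)ᴴ = pR (star z) := conjTranspose_matPow _
  have cC : ∀ z, (pC z)ᴴ = pC (star z) := conjTranspose_matPow _
  have half : (1 / 2 : ℂ) + 1 / 2 = 1 := by norm_num
  have shalf : star (1 / 2 : ℂ) = 1 / 2 := by simp
  -- `S = C^(1/2) R C^(1/2)` is a positive substitute for `R * C`: by cyclicity their powers have
  -- equal trace, and `S` has complex powers.
  set X := pR (1 / 2) * pC (1 / 2) with hX
  set S := Xᴴ * X with hSdef
  have hS : S.PosSemidef := posSemidef_conjTranspose_mul_self X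
  set pS := matPow hS.1
  have mS : ∀ z w, pS z * pS w = pS (z + w) := matPow_mul _
  have cS : ∀ z, (pS z)ᴴ = pS (star z) := conjTranspose_matPow _
  have S1 : pS 1 = S := matPow_one _ hS
  have hSe : S = pC (1 / 2) * (R * pC (1 / 2)) := by
    rw [hSdef, hX, conjTranspose_mul, cR, cC, shalf, Matrix.mul_assoc,
      ← Matrix.mul_assoc (pR _), mR, half]
    congr 2
    exact matPow_one _ hR
  have hTS : ((R * C) ^ k).trace = (pS k).trace := by
    rw [show pS k = S ^ k from matPow_natCast _ hS (by omega), hSe,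
      trace_mul_pow_comm (pC _), Matrix.mul_assoc, mC, half]
    congr 3
    exact (matPow_one _ hC).symm
  have hRk : R ^ k = pR k := (matPow_natCast _ hR (by omega)).symm
  have hCk : C ^ k = pC k := (matPow_natCast _ hC (by omega)).symm
  rw [hTS, hRk, hCk]
  -- At `z = 1/k` the first two factors form `X`, so `F (1/k) = Tr X S^(k-1) Xᴴ = Tr S^k`.
  set F : ℂ → ℂ := fun z =>
    (pR (k * z / 2) * pC (k * z / 2) * (pS (k - 1 / 2 - k * z / 2) * Xᴴ)).trace with hF
  -- the Hilbert-Schmidt norms of the two kinds of factors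
  have left_norm : ∀ z : ℂ, ((pR z * pC z) * (pR z * pC z)ᴴ).trace =
      (pR (z + star z) * pC (z + star z)).trace := fun z => by
    rw [conjTranspose_mul, cR, cC, trace_mul_comm, Matrix.mul_assoc, ← Matrix.mul_assoc (pR _),
      mR, trace_mul_comm, Matrix.mul_assoc, mC, add_comm (star z)]
  have right_norm : ∀ w : ℂ, ((pS w * Xᴴ)ᴴ * (pS w * Xᴴ)).trace =
      (pS (w + star w + 1)).trace := fun w => by
    rw [conjTranspose_mul, conjTranspose_conjTranspose, cS, Matrix.mul_assoc, trace_mul_comm,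
      ← Matrix.mul_assoc (pS _), mS, Matrix.mul_assoc, ← hSdef, ← S1, mS, add_comm (star w)]
  have T0 : 0 ≤ (pS k).trace.re := by
    have := trace_conjTranspose_mul_self_re_nonneg (pS (k / 2))
    rw [cS, mS] at this
    convert this using 4
    simp
  set T := (pS k).trace.re
  set G := (pR k * pC k).trace.re
  have hG0 : 0 ≤ G := by
    have := trace_conjTranspose_mul_self_re_nonneg (pR (k / 2) * pC (k / 2))
    rw [trace_mul_comm, left_norm] at this
    have e : (k / 2 : ℂ) + star (k / 2 : ℂ) = k := by simp
    rwa [e] at this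
  have hdiff : Differentiable ℂ F := by
    have hlin (A : Matrix n n ℂ) (h : A.IsHermitian) (a b : ℂ) (i j : n) :
        Differentiable ℂ fun z => matPow h (a + b * z) i j :=
      (differentiable_matPow h i j).comp (by fun_prop : Differentiable ℂ fun z : ℂ => a + b * z)
    have e1 : ∀ z : ℂ, k * z / 2 = 0 + (k / 2) * z := fun z => by ring
    have e2 : ∀ z : ℂ, k - 1 / 2 - k * z / 2 = (k - 1 / 2) + (-(k / 2)) * z := fun z => by ring
    simp only [hF, e2]
    simp only [e1]
    refine differentiable_trace (differentiable_mul_apply (differentiable_mul_apply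
      (hlin _ _ _ _) (hlin _ _ _ _)) (differentiable_mul_apply (hlin _ _ _ _) ?_))
    intro i j
    exact differentiable_const _
  have hbound : ∀ z : ℂ, ‖F z‖ ≤ √ (pR ((k * z.re : ℝ) : ℂ) * pC ((k * z.re : ℝ) : ℂ)).trace.re *
      √ (pS ((2 * k - k * z.re : ℝ) : ℂ)).trace.re := fun z => by
    refine (norm_trace_mul_le _ _).trans (le_of_eq ?_)
    rw [left_norm, right_norm]
    have e1 : k * z / 2 + star (k * z / 2) = ((k * z.re : ℝ) : ℂ) := by
      apply Complex.ext <;> simp; ring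
    have e2 : k - 1 / 2 - k * z / 2 + star (k - 1 / 2 - k * z / 2) + 1 =
        ((2 * k - k * z.re : ℝ) : ℂ) := by
      apply Complex.ext <;> simp <;> ring
    rw [e1, e2]
  -- The bound on `‖F z‖` depends continuously on `z.re` alone, which ranges over a compact
  -- interval.
  have hB : BddAbove ((norm ∘ F) '' Complex.HadamardThreeLines.verticalClosedStrip 0 1) := by
    have hc : ContinuousOn (fun x : ℝ => √ (pR ((k * x : ℝ) : ℂ) * pC ((k * x : ℝ) : ℂ)).trace.re *
        √ (pS ((2 * k - k * x : ℝ) : ℂ)).trace.re) (Set.Icc 0 1) := by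
      have h1 : Continuous fun z : ℂ => (pR z * pC z).trace :=
        (differentiable_trace (differentiable_mul_apply
          (differentiable_matPow _) (differentiable_matPow _))).continuous
      have h2 : Continuous fun z : ℂ => (pS z).trace :=
        (differentiable_trace (differentiable_matPow _)).continuous
      have h1' := h1.comp (by fun_prop : Continuous fun x : ℝ => ((k * x : ℝ) : ℂ))
      have h2' := h2.comp (by fun_prop : Continuous fun x : ℝ => ((2 * k - k * x : ℝ) : ℂ))
      exact ((Complex.continuous_re.comp h1').sqrt.mul
        (Complex.continuous_re.comp h2').sqrt).continuousOn
    obtain ⟨M, hM⟩ := isCompact_Icc.bddAbove_image hc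
    refine ⟨M, ?_⟩
    rintro _ ⟨z, hz, rfl⟩
    exact (hbound z).trans (hM ⟨z.re, hz, rfl⟩)
  -- Here `k z / 2` is imaginary, so the powers of `R` and `C` are partial isometries and can be
  -- dropped. Splitting off `S^(k/2)` makes both Hilbert–Schmidt norms at most `√T`.
  have ha : ∀ z ∈ Complex.re ⁻¹' {0}, ‖F z‖ ≤ T := by
    intro z hz
    have hz0 : z.re = 0 := hz
    have e : F z = ((pR (k * z / 2) * pC (k * z / 2) * pS (k / 2)) *
        (pS (k / 2 - 1 / 2 - k * z / 2) * Xᴴ)).trace := by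
      simp only [hF, Matrix.mul_assoc]
      rw [← Matrix.mul_assoc (pS _) (pS _), mS]
      congr 5
      ring_nf
    have hs : star (k * z / 2 : ℂ) + k * z / 2 = 0 := by
      apply Complex.ext <;> simp [hz0]; ring
    have proj : ∀ (A : Matrix n n ℂ) (h : A.IsHermitian) (B : Matrix n n ℂ),
        (Bᴴ * matPow h 0 * B).trace.re ≤ (Bᴴ * B).trace.re := fun A h B =>
      trace_conj_projection_le (by rw [conjTranspose_matPow, star_zero])
        (by rw [matPow_mul, add_zero]) B
    rw [e]
    refine (norm_trace_mul_le _ _).trans ?_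
    rw [right_norm, trace_mul_comm]
    have e2 : (k / 2 - 1 / 2 - k * z / 2 : ℂ) + star (k / 2 - 1 / 2 - k * z / 2 : ℂ) + 1 = k := by
      apply Complex.ext <;> simp [hz0] <;> ring
    have h1 : ((pR (k * z / 2) * pC (k * z / 2) * pS (k / 2))ᴴ *
        (pR (k * z / 2) * pC (k * z / 2) * pS (k / 2))).trace.re ≤ T := by
      calc _ = ((pC (k * z / 2) * pS (k / 2))ᴴ * pR 0 * (pC (k * z / 2) * pS (k / 2))).trace.re := by
            rw [← hs, ← mR, ← cR]
            simp only [conjTranspose_mul, Matrix.mul_assoc]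
        _ ≤ ((pC (k * z / 2) * pS (k / 2))ᴴ * (pC (k * z / 2) * pS (k / 2))).trace.re :=
            proj _ _ _
        _ = ((pS (k / 2))ᴴ * pC 0 * pS (k / 2)).trace.re := by
            rw [← hs, ← mC, ← cC]
            simp only [conjTranspose_mul, Matrix.mul_assoc]
        _ ≤ ((pS (k / 2))ᴴ * pS (k / 2)).trace.re := proj _ _ _
        _ = T := by
            rw [cS, mS, show star (k / 2 : ℂ) + k / 2 = k by simp]
    rw [e2]
    calc _ ≤ √ T * √ T := by gcongr
      _ = T := Real.mul_self_sqrt T0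
  have hb : ∀ z ∈ Complex.re ⁻¹' {1}, ‖F z‖ ≤ √ G * √ T := by
    intro z hz
    have hz1 : z.re = 1 := hz
    refine (hbound z).trans (le_of_eq ?_)
    rw [hz1, mul_one, show (2 * k - k : ℝ) = k by ring, Complex.ofReal_natCast]
  have hF1 : F (1 / k) = (pS k).trace := by
    simp only [hF]
    rw [show (k * (1 / k) / 2 : ℂ) = 1 / 2 by field_simp, ← hX,
      show (k - 1 / 2 - 1 / 2 : ℂ) = k - 1 by ring, trace_mul_comm, Matrix.mul_assoc, ← hSdef,
      ← S1, mS, sub_add_cancel]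
  have hmem : (1 / k : ℂ) ∈ Complex.HadamardThreeLines.verticalClosedStrip 0 1 := by
    have e : (1 / k : ℂ).re = 1 / k := by
      rw [show (1 / k : ℂ) = ((1 / k : ℝ) : ℂ) by push_cast; rfl, Complex.ofReal_re]
    simp only [Complex.HadamardThreeLines.verticalClosedStrip, Set.mem_preimage, e, Set.mem_Icc]
    exact ⟨by positivity, by rw [div_le_one hkr]; exact_mod_cast hk⟩
  have key := Complex.HadamardThreeLines.norm_le_interp_of_mem_verticalClosedStrip₀₁' F hmem
    hdiff.diffContOnCl hB ha hb
  have e : (1 / k : ℂ).re = 1 / k := by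
    rw [show (1 / k : ℂ) = ((1 / k : ℝ) : ℂ) by push_cast; rfl, Complex.ofReal_re]
  rw [hF1, e] at key
  have key2 : T ≤ T ^ (1 - 1 / k : ℝ) * (√ G * √ T) ^ (1 / k : ℝ) :=
    (Complex.re_le_norm _).trans key
  exact le_of_le_rpow_interp T0 hG0 hkr key2

/-! ### Functional calculus of a hermitian matrix -/

section cfc

variable {A : Matrix n n ℂ} (hA : A.IsHermitian)

/-- The spectrum is finite, so continuity is automatic and the calculus covers step functions and
negative powers. -/
lemma continuousOn_spectrum_matrix (f : ℝ → ℝ) (A : Matrix n n ℂ) :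
    ContinuousOn f (spectrum ℝ A) := by
  rw [continuousOn_iff_continuous_domRestrict]
  fun_prop

lemma cfc_eq_conj_diagonal (f : ℝ → ℝ) :
    cfc f A = (hA.eigenvectorUnitary : Matrix n n ℂ) *
      diagonal (fun i => (f (hA.eigenvalues i) : ℂ)) *
      star (hA.eigenvectorUnitary : Matrix n n ℂ) := by
  rw [hA.cfc_eq, IsHermitian.cfc, Unitary.conjStarAlgAut_apply]
  rfl

lemma trace_mul_cfc (f : ℝ → ℝ) (B : Matrix n n ℂ) :
    (B * cfc f A).trace = ∑ i, (star (hA.eigenvectorUnitary : Matrix n n ℂ) * B *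
      (hA.eigenvectorUnitary : Matrix n n ℂ)) i i * (f (hA.eigenvalues i) : ℂ) := by
  rw [cfc_eq_conj_diagonal hA, ← Matrix.mul_assoc, trace_mul_comm, ← Matrix.mul_assoc,
    ← Matrix.mul_assoc]
  simp [trace, mul_diagonal]

lemma trace_cfc (f : ℝ → ℝ) : (cfc f A).trace = ∑ i, (f (hA.eigenvalues i) : ℂ) := by
  rw [cfc_eq_conj_diagonal hA, trace_mul_comm, ← Matrix.mul_assoc, Unitary.coe_star_mul_self,
    Matrix.one_mul, trace_diagonal]

lemma trace_cfc_re (f : ℝ → ℝ) : (cfc f A).trace.re = ∑ i, f (hA.eigenvalues i) := by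
  rw [trace_cfc hA, ← Complex.ofReal_sum, Complex.ofReal_re]

lemma cfc_sub_smul_one (hA : A.IsHermitian) (f : ℝ → ℝ) (c : ℝ) :
    cfc f (A - (c : ℂ) • (1 : Matrix n n ℂ)) = cfc (fun x => f (x - c)) A := by
  have hA' : IsSelfAdjoint A := hA
  have e : A - (c : ℂ) • (1 : Matrix n n ℂ) = cfc (fun x : ℝ => x - c) A := by
    rw [cfc_sub (fun x => x) (fun _ => c) A, cfc_id' ℝ A, cfc_const c A, Algebra.algebraMap_eq_smul_one]
    simp
  rw [e, ← cfc_comp' f (fun x => x - c) A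
    (by rw [continuousOn_iff_continuous_domRestrict]
        have : Finite ((fun x : ℝ => x - c) '' spectrum ℝ A) :=
          (A.finite_real_spectrum.image _)
        fun_prop)
    (continuousOn_spectrum_matrix _ _)]

lemma star_dotProduct_mulVec_re (x : n → ℂ) :
    (star x ⬝ᵥ A *ᵥ x).re = ∑ i, hA.eigenvalues i *
      ‖(star (hA.eigenvectorUnitary : Matrix n n ℂ) *ᵥ x) i‖ ^ 2 := by
  conv_lhs => rw [hA.spectral_theorem, Unitary.conjStarAlgAut_apply]
  rw [← mulVec_mulVec, ← mulVec_mulVec, dotProduct_mulVec]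
  have : star x ᵥ* (hA.eigenvectorUnitary : Matrix n n ℂ) =
      star (star (hA.eigenvectorUnitary : Matrix n n ℂ) *ᵥ x) := by
    rw [star_mulVec, star_eq_conjTranspose, conjTranspose_conjTranspose]
  rw [this]
  simp only [dotProduct, mulVec_diagonal, Complex.re_sum, Pi.star_apply]
  refine Finset.sum_congr rfl fun i _ => ?_
  rw [mul_left_comm, Complex.star_def, Complex.conj_mul', Function.comp_apply,
    ← Complex.ofReal_pow]
  exact Complex.re_ofReal_mul _ _

end cfc

/-! ### Counting positive eigenvalues -/

/-- The number of positive eigenvalues of a hermitian matrix. -/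
def posCount (X : Matrix n n ℂ) : ℝ :=
  (cfc (fun x : ℝ => if 0 < x then (1 : ℝ) else 0) X).trace.re

lemma posCount_eq_sum {A : Matrix n n ℂ} (hA : A.IsHermitian) :
    posCount A = ∑ i, if 0 < hA.eigenvalues i then (1 : ℝ) else 0 :=
  trace_cfc_re hA _

lemma posCount_sub_smul_one {A : Matrix n n ℂ} (hA : A.IsHermitian) (c : ℝ) :
    posCount (A - (c : ℂ) • (1 : Matrix n n ℂ)) =
      ∑ i, if c < hA.eigenvalues i then (1 : ℝ) else 0 := by
  rw [posCount, cfc_sub_smul_one hA, trace_cfc_re hA]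
  simp only [sub_pos]

lemma posCount_eq_card {A : Matrix n n ℂ} (hA : A.IsHermitian) :
    posCount A = Fintype.card {i // 0 < hA.eigenvalues i} := by
  rw [posCount_eq_sum hA, Finset.sum_boole, Fintype.card_subtype]

/-- A dimension count: `S`, followed by projection onto the positive eigenvectors of `B`, is
injective on the span of those of `A`, because a vector in its kernel would have nonpositive
`B`-form. -/
lemma posCount_le_of_form {A B : Matrix n n ℂ} (hA : A.IsHermitian) (hB : B.IsHermitian)
    (S : Matrix n n ℂ) (h : ∀ x : n → ℂ, 0 < (star x ⬝ᵥ A *ᵥ x).re →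
      0 < (star (S *ᵥ x) ⬝ᵥ B *ᵥ (S *ᵥ x)).re) : posCount A ≤ posCount B := by
  rw [posCount_eq_card hA, posCount_eq_card hB, Nat.cast_le]
  let L : ({i // 0 < hA.eigenvalues i} → ℂ) →ₗ[ℂ] ({i // 0 < hB.eigenvalues i} → ℂ) :=
    (LinearMap.funLeft ℂ ℂ Subtype.val).comp
      ((star (hB.eigenvectorUnitary : Matrix n n ℂ) * (S *
        (hA.eigenvectorUnitary : Matrix n n ℂ))).mulVecLin.comp
          (Function.ExtendByZero.linearMap ℂ Subtype.val))
  have hL : Function.Injective L := by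
    rw [injective_iff_map_eq_zero]
    intro c hc
    by_contra hne
    obtain ⟨i, hi⟩ := Function.ne_iff.mp hne
    set e : n → ℂ := Function.extend Subtype.val c 0 with he
    have hei : ∀ i : {i // 0 < hA.eigenvalues i}, e i = c i := fun i =>
      Subtype.val_injective.extend_apply _ _ _
    have he0 : ∀ i, ¬ 0 < hA.eigenvalues i → e i = 0 := fun i hi => by
      rw [he, Function.extend_apply' _ _ _ (by rintro ⟨a, rfl⟩; exact hi a.2)]
      rfl
    have hpos : 0 < (star ((hA.eigenvectorUnitary : Matrix n n ℂ) *ᵥ e) ⬝ᵥ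
        A *ᵥ ((hA.eigenvectorUnitary : Matrix n n ℂ) *ᵥ e)).re := by
      rw [star_dotProduct_mulVec_re hA, mulVec_mulVec, Unitary.coe_star_mul_self, one_mulVec]
      refine Finset.sum_pos' (fun j _ => ?_) ⟨i, Finset.mem_univ _, ?_⟩
      · by_cases hj : 0 < hA.eigenvalues j
        · positivity
        · simp [he0 j hj]
      · have := i.2
        have : 0 < ‖e i‖ := by rw [hei]; exact norm_pos_iff.mpr hi
        positivity
    refine (h _ hpos).not_ge ?_
    rw [star_dotProduct_mulVec_re hB]
    refine Finset.sum_nonpos fun j _ => ?_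
    by_cases hj : 0 < hB.eigenvalues j
    · have : L c ⟨j, hj⟩ = 0 := by rw [hc]; rfl
      have h0 : (star (hB.eigenvectorUnitary : Matrix n n ℂ) *ᵥ S *ᵥ
          (hA.eigenvectorUnitary : Matrix n n ℂ) *ᵥ e) j = 0 := by
        rw [mulVec_mulVec, mulVec_mulVec, Matrix.mul_assoc]
        exact this
      rw [h0]; simp
    · exact mul_nonpos_of_nonpos_of_nonneg (not_lt.mp hj) (by positivity)
  simpa using LinearMap.finrank_le_finrank_of_injective hL

/-- **Sylvester's law of inertia** for the number of positive eigenvalues. -/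
lemma posCount_conj {A T T' : Matrix n n ℂ} (hA : A.IsHermitian) (hT : T * T' = 1) :
    posCount (Tᴴ * A * T) = posCount A := by
  have hB : (Tᴴ * A * T).IsHermitian := isHermitian_conjTranspose_mul_mul _ hA
  have form : ∀ x, star x ⬝ᵥ (Tᴴ * A * T) *ᵥ x = star (T *ᵥ x) ⬝ᵥ A *ᵥ (T *ᵥ x) := fun x => by
    rw [star_mulVec, ← dotProduct_mulVec, mulVec_mulVec, mulVec_mulVec, Matrix.mul_assoc]
  refine le_antisymm (posCount_le_of_form hB hA T fun x hx => by rwa [form] at hx)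
    (posCount_le_of_form hA hB T' fun x hx => ?_)
  rwa [form, mulVec_mulVec, hT, one_mulVec]

open scoped Matrix.Norms.L2Operator in
lemma continuous_trace_cfc {X : Type*} [TopologicalSpace X] {f : ℝ → ℝ} (hf : Continuous f)
    {a : X → Matrix n n ℂ} (ha : Continuous a) (hh : ∀ x, (a x).IsHermitian) :
    Continuous fun x => (cfc f (a x)).trace.re := by
  have h : Continuous fun x => cfc f (a x) :=
    Continuous.cfc_of_mem_nhdsSet (s := Set.univ) f Filter.univ_mem ha hh hf.continuousOn
  exact Complex.continuous_re.comp h.matrix_trace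

/-- The step function is the pointwise limit of the continuous functions `min (m * max y 0) 1`.
Measurability is needed to exchange the integrals over `s` and `t`. -/
lemma measurable_posCount {X : Type*} [TopologicalSpace X] [MeasurableSpace X] [BorelSpace X]
    {a : X → Matrix n n ℂ} (ha : Continuous a) (hh : ∀ x, (a x).IsHermitian) :
    Measurable fun x => posCount (a x) := by
  refine measurable_of_tendsto_metrizable
    (f := fun (m : ℕ) x => (cfc (fun y : ℝ => min (m * max y 0) 1) (a x)).trace.re)
    (fun m => (continuous_trace_cfc (by fun_prop) ha hh).measurable) ?_
  rw [tendsto_pi_nhds]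
  intro x
  rw [posCount_eq_sum (hh x)]
  simp only [trace_cfc_re (hh x)]
  refine tendsto_finsetSum _ fun i _ => ?_
  split_ifs with h
  · refine tendsto_const_nhds.congr' ?_
    obtain ⟨N, hN⟩ := exists_nat_gt (1 / (hh x).eigenvalues i)
    filter_upwards [Filter.eventually_ge_atTop N] with m hm
    rw [max_eq_left h.le, eq_comm, min_eq_right]
    have : (N : ℝ) ≤ m := by exact_mod_cast hm
    rw [div_lt_iff₀ h] at hN
    nlinarith
  · rw [max_eq_right (not_lt.mp h)]
    simp

/-! ### Layer-cake formulas -/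

lemma lintegral_Ioi_indicator_lt {s : ℝ} (hs : 0 < s) (a : ℝ) :
    ENNReal.ofReal s * ∫⁻ t in Set.Ioi (0 : ℝ), ENNReal.ofReal (if s * t < a then 1 else 0) =
      ENNReal.ofReal (max a 0) := by
  have : ∀ t : ℝ, ENNReal.ofReal (if s * t < a then 1 else 0) =
      (Set.Iio (a / s)).indicator 1 t := fun t => by
    simp only [Set.indicator, Set.mem_Iio, lt_div_iff₀ hs, mul_comm t s]
    split_ifs <;> simp
  simp only [this]
  rw [lintegral_indicator_one measurableSet_Iio, Measure.restrict_apply measurableSet_Iio,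
    Set.inter_comm, Set.Ioi_inter_Iio, Real.volume_Ioo, sub_zero, ← ENNReal.ofReal_mul hs.le,
    mul_div_cancel₀ _ hs.ne']
  rcases le_total a 0 with h | h
  · rw [max_eq_right h, ENNReal.ofReal_of_nonpos h, ENNReal.ofReal_zero]
  · rw [max_eq_left h]

/-- Layer cake for the positive part, with the level written as `s * t` so that `X = ρ - s σ` gives
`ρ - s (σ + t)`. -/
lemma ofReal_tracePosPart {X : Matrix n n ℂ} (hX : X.IsHermitian) {s : ℝ} (hs : 0 < s) :
    ENNReal.ofReal (tracePosPart X) = ENNReal.ofReal s *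
      ∫⁻ t in Set.Ioi (0 : ℝ),
        ENNReal.ofReal (posCount (X - ((s * t : ℝ) : ℂ) • (1 : Matrix n n ℂ))) := by
  simp only [posCount_sub_smul_one hX]
  rw [tracePosPart, trace_cfc_re hX, ENNReal.ofReal_sum_of_nonneg (fun i _ => le_max_right _ _)]
  have : ∀ t : ℝ, ENNReal.ofReal (∑ i, if s * t < hX.eigenvalues i then (1 : ℝ) else 0) =
      ∑ i, ENNReal.ofReal (if s * t < hX.eigenvalues i then (1 : ℝ) else 0) := fun t =>
    ENNReal.ofReal_sum_of_nonneg (fun i _ => by split_ifs <;> norm_num)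
  simp only [this]
  rw [lintegral_finsetSum', Finset.mul_sum]
  · exact Finset.sum_congr rfl fun i _ => (lintegral_Ioi_indicator_lt hs _).symm
  · intro i _
    refine (Measurable.ite ?_ measurable_const measurable_const).ennreal_ofReal.aemeasurable
    exact measurableSet_lt (by fun_prop) measurable_const

lemma lintegral_pow_indicator_lt (k : ℕ) {a : ℝ} (ha : 0 ≤ a) :
    ∫⁻ s in Set.Ioi (0 : ℝ), ENNReal.ofReal ((k + 1) * s ^ k) *
      ENNReal.ofReal (if s < a then 1 else 0) = ENNReal.ofReal (a ^ (k + 1)) := by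
  have : ∀ s : ℝ, ENNReal.ofReal ((k + 1) * s ^ k) * ENNReal.ofReal (if s < a then 1 else 0) =
      (Set.Iio a).indicator (fun s => ENNReal.ofReal ((k + 1) * s ^ k)) s := fun s => by
    simp only [Set.indicator, Set.mem_Iio]
    split_ifs <;> simp
  simp only [this]
  rw [lintegral_indicator measurableSet_Iio, Measure.restrict_restrict measurableSet_Iio,
    Set.inter_comm, Set.Ioi_inter_Iio, restrict_Ioo_eq_restrict_Ioc,
    ← ofReal_integral_eq_lintegral_ofReal, ← intervalIntegral.integral_of_le ha]
  · congr 1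
    rw [intervalIntegral.integral_const_mul, integral_pow]
    have : (k + 1 : ℝ) ≠ 0 := by positivity
    field_simp
    simp
  · exact (Continuous.integrableOn_Icc (by fun_prop)).mono_set Set.Ioc_subset_Icc_self
  · rw [Filter.EventuallyLE, ae_restrict_iff' measurableSet_Ioc]
    refine Filter.Eventually.of_forall fun s hs => ?_
    have := hs.1
    simp only [Pi.zero_apply]
    positivity

lemma trace_pow_re {M : Matrix n n ℂ} (hM : M.IsHermitian) (k : ℕ) :
    (M ^ k).trace.re = ∑ i, hM.eigenvalues i ^ k := by
  have hM' : IsSelfAdjoint M := hM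
  rw [← cfc_pow_id (R := ℝ) M k, trace_cfc_re hM]

lemma lintegral_pow_mul_posCount {M : Matrix n n ℂ} (hM : M.PosSemidef) (k : ℕ) :
    ∫⁻ s in Set.Ioi (0 : ℝ), ENNReal.ofReal ((k + 1) * s ^ k) *
      ENNReal.ofReal (posCount (M - (s : ℂ) • (1 : Matrix n n ℂ))) =
    ENNReal.ofReal (M ^ (k + 1)).trace.re := by
  have hH := hM.1
  simp only [posCount_sub_smul_one hH]
  rw [trace_pow_re hH, ENNReal.ofReal_sum_of_nonneg
    (fun i _ => pow_nonneg (hM.eigenvalues_nonneg i) _)]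
  have : ∀ s : ℝ, ENNReal.ofReal ((k + 1) * s ^ k) *
      ENNReal.ofReal (∑ i, if s < hH.eigenvalues i then (1 : ℝ) else 0) =
      ∑ i, ENNReal.ofReal ((k + 1) * s ^ k) *
        ENNReal.ofReal (if s < hH.eigenvalues i then (1 : ℝ) else 0) := fun s => by
    rw [ENNReal.ofReal_sum_of_nonneg (fun i _ => by split_ifs <;> norm_num), Finset.mul_sum]
  simp only [this]
  rw [lintegral_finsetSum']
  · exact Finset.sum_congr rfl fun i _ =>
      lintegral_pow_indicator_lt k (hM.eigenvalues_nonneg i)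
  · intro i _
    refine Measurable.aemeasurable (Measurable.mul (f := fun s : ℝ => ENNReal.ofReal ((k + 1) * s ^ k))
      (by fun_prop) ?_)
    refine (Measurable.ite ?_ measurable_const measurable_const).ennreal_ofReal
    exact measurableSet_lt measurable_id measurable_const

/-! ### The moments of the hockey-stick divergence -/

lemma cfc_congr_eigenvalues {A : Matrix n n ℂ} (hA : A.IsHermitian) {f g : ℝ → ℝ}
    (h : ∀ i, f (hA.eigenvalues i) = g (hA.eigenvalues i)) : cfc f A = cfc g A := by
  simp only [cfc_eq_conj_diagonal hA, h]

lemma cfc_mul_cfc (f g : ℝ → ℝ) (A : Matrix n n ℂ) :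
    cfc f A * cfc g A = cfc (fun x => f x * g x) A :=
  (cfc_mul f g A (continuousOn_spectrum_matrix _ _) (continuousOn_spectrum_matrix _ _)).symm

lemma isHermitian_cfc (f : ℝ → ℝ) (A : Matrix n n ℂ) : (cfc f A).IsHermitian :=
  cfc_predicate f A

/-- `(σ + t)^{-1/2} ρ (σ + t)^{-1/2}`. -/
def shiftedSandwich (ρ σ : Matrix n n ℂ) (t : ℝ) : Matrix n n ℂ :=
  cfc (fun x : ℝ => (√(x + t))⁻¹) σ * ρ * cfc (fun x : ℝ => (√(x + t))⁻¹) σ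

lemma posSemidef_cfc_mul_mul_cfc {ρ : Matrix n n ℂ} (hρ : ρ.PosSemidef) (f : ℝ → ℝ)
    (σ : Matrix n n ℂ) : (cfc f σ * ρ * cfc f σ).PosSemidef := by
  have := hρ.conjTranspose_mul_mul_same (cfc f σ)
  rwa [(isHermitian_cfc f σ).eq] at this

/-- Congruence by `(σ + t)^(1/2)`, invertible because `t > 0` even when `σ` is singular. -/
lemma posCount_sub_add {ρ σ : Matrix n n ℂ} (hρ : ρ.PosSemidef) (hσ : σ.PosSemidef) (s : ℝ)
    {t : ℝ} (ht : 0 < t) :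
    posCount (ρ - (s : ℂ) • σ - ((s * t : ℝ) : ℂ) • (1 : Matrix n n ℂ)) =
      posCount (shiftedSandwich ρ σ t - (s : ℂ) • (1 : Matrix n n ℂ)) := by
  set T := cfc (fun x : ℝ => √(x + t)) σ with hT
  set T' := cfc (fun x : ℝ => (√(x + t))⁻¹) σ with hT'
  have hσ' : IsSelfAdjoint σ := hσ.1
  have pos : ∀ i, 0 < hσ.1.eigenvalues i + t := fun i =>
    add_pos_of_nonneg_of_pos (hσ.eigenvalues_nonneg i) ht
  have hTT' : T * T' = 1 := by
    rw [hT, hT', cfc_mul_cfc, ← cfc_const_one ℝ σ]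
    refine cfc_congr_eigenvalues hσ.1 fun i => mul_inv_cancel₀ ?_
    exact (Real.sqrt_pos.mpr (pos i)).ne'
  have hT'T : T' * T = 1 := mul_eq_one_comm.mp hTT'
  have hTT : T * T = σ + (t : ℂ) • (1 : Matrix n n ℂ) := by
    have : σ + (t : ℂ) • (1 : Matrix n n ℂ) = cfc (fun x : ℝ => x + t) σ := by
      rw [cfc_add σ (fun x => x) (fun _ => t), cfc_id' ℝ σ, cfc_const t σ,
        Algebra.algebraMap_eq_smul_one]
      simp
    rw [this, hT, cfc_mul_cfc]
    exact cfc_congr_eigenvalues hσ.1 fun i => Real.mul_self_sqrt (pos i).le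
  have hM : (shiftedSandwich ρ σ t - (s : ℂ) • (1 : Matrix n n ℂ)).IsHermitian := by
    refine (posSemidef_cfc_mul_mul_cfc hρ _ σ).1.sub ?_
    simp [IsHermitian, conjTranspose_smul]
  rw [← posCount_conj hM hTT', (isHermitian_cfc _ _ : T.IsHermitian).eq]
  congr 1
  rw [shiftedSandwich, ← hT', Matrix.mul_sub, Matrix.sub_mul]
  have e1 : T * (T' * ρ * T') * T = ρ := by
    calc _ = (T * T') * ρ * (T' * T) := by simp only [Matrix.mul_assoc]
      _ = ρ := by rw [hTT', hT'T, Matrix.one_mul, Matrix.mul_one]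
  rw [e1, Matrix.mul_smul, Matrix.mul_one, Matrix.smul_mul, hTT, smul_add, smul_smul, sub_sub]
  push_cast
  rfl

omit [Fintype n] [DecidableEq n] in
lemma isHermitian_sub_smul {ρ σ : Matrix n n ℂ} (hρ : ρ.IsHermitian) (hσ : σ.IsHermitian)
    (s : ℝ) : (ρ - (s : ℂ) • σ).IsHermitian := by
  refine hρ.sub ?_
  rw [IsHermitian, conjTranspose_smul, hσ.eq]
  simp

theorem lintegral_pow_mul_hockeyStick {ρ σ : Matrix n n ℂ} (hρ : ρ.PosSemidef)
    (hσ : σ.PosSemidef) (k : ℕ) :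
    ∫⁻ s in Set.Ioi (0 : ℝ), ENNReal.ofReal ((k + 1 + 1) * (k + 1) * s ^ k) *
      ENNReal.ofReal (hockeyStick s ρ σ) =
    ∫⁻ t in Set.Ioi (0 : ℝ), ENNReal.ofReal
      ((k + 1) * (shiftedSandwich ρ σ t ^ (k + 2)).trace.re) := by
  set N : ℝ → ℝ → ℝ := fun s t =>
    posCount (ρ - (s : ℂ) • σ - ((s * t : ℝ) : ℂ) • (1 : Matrix n n ℂ)) with hN
  have herm : ∀ s t : ℝ,
      (ρ - (s : ℂ) • σ - ((s * t : ℝ) : ℂ) • (1 : Matrix n n ℂ)).IsHermitian := fun s t =>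
    isHermitian_sub_smul (isHermitian_sub_smul hρ.1 hσ.1 s) isHermitian_one _
  have hmeas : Measurable (Function.uncurry fun s t => ENNReal.ofReal (k + 1) *
      (ENNReal.ofReal (((k + 1 : ℕ) + 1) * s ^ (k + 1)) * ENNReal.ofReal (N s t))) := by
    have : Measurable fun p : ℝ × ℝ => N p.1 p.2 :=
      measurable_posCount (by fun_prop) fun p => herm p.1 p.2
    unfold Function.uncurry
    fun_prop
  -- The factor `s` from the rescaled layer cake raises `s ^ k` to `s ^ (k + 1)`, the weight that
  -- produces the trace of the power `k + 2`.
  calc _ = ∫⁻ s in Set.Ioi (0 : ℝ), ∫⁻ t in Set.Ioi (0 : ℝ), ENNReal.ofReal (k + 1) *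
      (ENNReal.ofReal (((k + 1 : ℕ) + 1) * s ^ (k + 1)) * ENNReal.ofReal (N s t)) := by
        refine setLIntegral_congr_fun measurableSet_Ioi fun s hs => ?_
        have hs' : (0 : ℝ) < s := hs
        rw [hockeyStick, ofReal_tracePosPart (isHermitian_sub_smul hρ.1 hσ.1 s) hs',
          ← mul_assoc, ← ENNReal.ofReal_mul (by positivity)]
        have mN : Measurable fun t => N s t :=
          measurable_posCount (by fun_prop) fun t => herm s t
        rw [← lintegral_const_mul _ mN.ennreal_ofReal]
        refine lintegral_congr fun t => ?_
        rw [← mul_assoc (ENNReal.ofReal (k + 1)), ← ENNReal.ofReal_mul (p := (k : ℝ) + 1) (by positivity)]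
        congr 2
        push_cast
        ring
    _ = ∫⁻ t in Set.Ioi (0 : ℝ), ∫⁻ s in Set.Ioi (0 : ℝ), ENNReal.ofReal (k + 1) *
      (ENNReal.ofReal (((k + 1 : ℕ) + 1) * s ^ (k + 1)) * ENNReal.ofReal (N s t)) :=
        lintegral_lintegral_swap hmeas.aemeasurable
    _ = _ := by
        refine setLIntegral_congr_fun measurableSet_Ioi fun t ht => ?_
        have hM : (shiftedSandwich ρ σ t).PosSemidef := posSemidef_cfc_mul_mul_cfc hρ _ σ
        rw [lintegral_const_mul' _ _ ENNReal.ofReal_ne_top, ENNReal.ofReal_mul (by positivity),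
          ← lintegral_pow_mul_posCount hM (k + 1)]
        congr 1
        refine lintegral_congr fun s => ?_
        rw [← posCount_sub_add hρ hσ s ht]

/-! ### Comparison with the sandwiched trace -/

/-- The antiderivative is `-(x / (x + t)) ^ (k + 1)`. The value is `1` for `x > 0` and `0` for `x =
0`. -/
lemma lintegral_Ioi_pow_div_add_pow_le {x : ℝ} (hx : 0 ≤ x) (k : ℕ) :
    ∫⁻ t in Set.Ioi (0 : ℝ), ENNReal.ofReal ((k + 1) * (x ^ (k + 1) / (x + t) ^ (k + 2))) ≤ 1 := by
  rcases hx.eq_or_lt with rfl | hx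
  · simp
  have hderiv : ∀ t ∈ Set.Ici (0 : ℝ), HasDerivAt (fun t : ℝ => -(x ^ (k + 1) / (x + t) ^ (k + 1)))
      ((k + 1) * (x ^ (k + 1) / (x + t) ^ (k + 2))) t := fun t ht => by
    have ht' : (0 : ℝ) ≤ t := ht
    have hne : x + t ≠ 0 := by positivity
    have h1 : HasDerivAt (fun t : ℝ => (x + t) ^ (k + 1)) ((k + 1 : ℕ) * (x + t) ^ k * 1) t := by
      simpa using ((hasDerivAt_id t).const_add x).fun_pow (k + 1)
    have h2 := ((hasDerivAt_const t (x ^ (k + 1))).div h1 (pow_ne_zero _ hne)).neg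
    refine HasDerivAt.congr_deriv h2 ?_
    push_cast
    field_simp
    ring
  have hlim : Filter.Tendsto (fun t : ℝ => -(x ^ (k + 1) / (x + t) ^ (k + 1))) Filter.atTop
      (nhds 0) := by
    rw [← neg_zero]
    refine (Filter.Tendsto.const_div_atTop ?_ _).neg
    exact (Filter.tendsto_pow_atTop (Nat.succ_ne_zero k)).comp
      (Filter.tendsto_atTop_add_const_left _ _ Filter.tendsto_id)
  have hpos : ∀ t ∈ Set.Ioi (0 : ℝ), 0 ≤ (k + 1 : ℝ) * (x ^ (k + 1) / (x + t) ^ (k + 2)) :=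
    fun t ht => by
      have ht' : (0 : ℝ) < t := ht
      positivity
  have hint := integrableOn_Ioi_deriv_of_nonneg' hderiv hpos hlim
  rw [← ofReal_integral_eq_lintegral_ofReal hint
    ((ae_restrict_iff' measurableSet_Ioi).mpr (Filter.Eventually.of_forall hpos)),
    integral_Ioi_of_hasDerivAt_of_tendsto' hderiv hint hlim]
  rw [add_zero, div_self (by positivity)]
  simp

lemma supp_projection_mul {ρ σ : Matrix n n ℂ} (hσ : σ.IsHermitian) (h : SuppLE ρ σ) :
    cfc (fun x : ℝ => if x = 0 then (0 : ℝ) else 1) σ * ρ = ρ := by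
  have hσ' : IsSelfAdjoint σ := hσ
  have hP : cfc (fun x : ℝ => if x = 0 then (0 : ℝ) else 1) σ * σ = σ := by
    conv_lhs => rw [← cfc_id' ℝ σ, cfc_id' ℝ σ]
    nth_rewrite 2 [← cfc_id' ℝ σ]
    rw [cfc_mul_cfc]
    conv_rhs => rw [← cfc_id' ℝ σ]
    refine cfc_congr_eigenvalues hσ fun i => ?_
    split_ifs with h <;> simp [h]
  refine ext_of_mulVec_single fun i => ?_
  obtain ⟨y, hy⟩ := h ⟨Pi.single i 1, rfl⟩
  simp only [mulVecLin_apply] at hy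
  rw [← mulVec_mulVec, ← hy, mulVec_mulVec, hP]

/-- Araki–Lieb–Thirring for `R` and `D * D`, where `D = (σ + t)^(-1/2) σ^(-p)` and `M_t = D R D`.
The choice of `p` gives `-2p(k + 2) = k + 1`, the power of `x` on the right. -/
theorem trace_shiftedSandwich_pow_le {ρ σ : Matrix n n ℂ} (hρ : ρ.PosSemidef)
    (hσ : σ.PosSemidef) (h : SuppLE ρ σ) (k : ℕ) {p : ℝ} (hp : p = -((k + 1) / (2 * (k + 2))))
    {t : ℝ} (ht : 0 < t) :
    (shiftedSandwich ρ σ t ^ (k + 2)).trace.re ≤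
      ((opPow σ p * ρ * opPow σ p) ^ (k + 2) *
        cfc (fun x : ℝ => x ^ (k + 1) / (x + t) ^ (k + 2)) σ).trace.re := by
  have hσ' : IsSelfAdjoint σ := hσ.1
  set R := opPow σ p * ρ * opPow σ p with hR
  have hRpos : R.PosSemidef := posSemidef_cfc_mul_mul_cfc hρ _ σ
  have hp0 : p ≠ 0 := by rw [hp]; exact neg_ne_zero.mpr (by positivity)
  set P := cfc (fun x : ℝ => if x = 0 then (0 : ℝ) else 1) σ with hP
  set T' := cfc (fun x : ℝ => (√(x + t))⁻¹) σ with hT'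
  set D := cfc (fun x : ℝ => (√(x + t))⁻¹ * x ^ (-p)) σ with hD
  have hPρ : P * ρ = ρ := supp_projection_mul hσ.1 h
  have hρP : ρ * P = ρ := by
    have := congrArg conjTranspose hPρ
    rwa [conjTranspose_mul, hρ.1.eq, (isHermitian_cfc _ _ : P.IsHermitian).eq] at this
  -- On the kernel of `σ` both sides vanish, as `0 ^ p = 0`; hence the support projection `P`, which
  -- `ρ` absorbs.
  have hDp : D * opPow σ p = T' * P := by
    rw [hD, opPow, cfc_mul_cfc, hT', hP, cfc_mul_cfc]
    refine cfc_congr_eigenvalues hσ.1 fun i => ?_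
    split_ifs with h0
    · rw [h0, Real.zero_rpow hp0]; simp
    · have hpos := lt_of_le_of_ne (hσ.eigenvalues_nonneg i) (Ne.symm h0)
      rw [mul_assoc, ← Real.rpow_add hpos, neg_add_cancel, Real.rpow_zero]
  have hpD : opPow σ p * D = P * T' := by
    have := congrArg conjTranspose hDp
    have hs : (opPow σ p).IsHermitian := isHermitian_cfc _ _
    have hDh : D.IsHermitian := isHermitian_cfc _ _
    have hPh : P.IsHermitian := isHermitian_cfc _ _
    have hTh : T'.IsHermitian := isHermitian_cfc _ _
    rwa [conjTranspose_mul, conjTranspose_mul, hDh.eq, hs.eq, hPh.eq, hTh.eq] at this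
  have hM : shiftedSandwich ρ σ t = D * R * D := by
    calc shiftedSandwich ρ σ t = T' * (P * ρ * P) * T' := by rw [hPρ, hρP]; rfl
      _ = (T' * P) * ρ * (P * T') := by simp only [Matrix.mul_assoc]
      _ = D * R * D := by rw [← hDp, ← hpD, hR]; simp only [Matrix.mul_assoc]
  have hDD : (D * D) ^ (k + 2) = cfc (fun x : ℝ => x ^ (k + 1) / (x + t) ^ (k + 2)) σ := by
    rw [hD, cfc_mul_cfc, ← cfc_pow _ _ σ (continuousOn_spectrum_matrix _ _)]
    refine cfc_congr_eigenvalues hσ.1 fun i => ?_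
    set x := hσ.1.eigenvalues i
    have hx : 0 ≤ x := hσ.eigenvalues_nonneg i
    have e1 : (√(x + t))⁻¹ * (√(x + t))⁻¹ = (x + t)⁻¹ := by
      rw [← mul_inv, Real.mul_self_sqrt (by positivity)]
    have e2 : (x ^ (-p) * x ^ (-p)) ^ (k + 2) = x ^ (k + 1) := by
      have hp' : 0 ≤ -p := by rw [hp, neg_neg]; positivity
      rw [← Real.rpow_add_of_nonneg hx hp' hp', ← Real.rpow_natCast, ← Real.rpow_mul hx,
        ← Real.rpow_natCast]
      congr 1
      rw [hp]
      push_cast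
      field_simp
      ring
    calc _ = ((√(x + t))⁻¹ * (√(x + t))⁻¹) ^ (k + 2) * (x ^ (-p) * x ^ (-p)) ^ (k + 2) := by ring
      _ = _ := by rw [e1, e2, inv_pow]; field_simp
  have hDpos : (D * D).PosSemidef := by
    have := posSemidef_conjTranspose_mul_self D
    rwa [(isHermitian_cfc _ _ : D.IsHermitian).eq] at this
  rw [hM, trace_mul_pow_comm, ← Matrix.mul_assoc, trace_mul_pow_comm, ← hDD]
  exact trace_mul_pow_le hRpos hDpos (by omega)

/-- In an eigenbasis of `σ` the bound is a sum of scalar integrals weighted by the diagonal entries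
`w i ≥ 0` of `R ^ (k + 2)`, which add up to its trace. -/
theorem lintegral_trace_shiftedSandwich_pow_le {ρ σ : Matrix n n ℂ} (hρ : ρ.PosSemidef)
    (hσ : σ.PosSemidef) (h : SuppLE ρ σ) (k : ℕ) {p : ℝ}
    (hp : p = -((k + 1) / (2 * (k + 2)))) :
    ∫⁻ t in Set.Ioi (0 : ℝ), ENNReal.ofReal
      ((k + 1) * (shiftedSandwich ρ σ t ^ (k + 2)).trace.re) ≤
    ENNReal.ofReal ((opPow σ p * ρ * opPow σ p) ^ (k + 2)).trace.re := by
  set R := opPow σ p * ρ * opPow σ p with hR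
  have hRpos : R.PosSemidef := posSemidef_cfc_mul_mul_cfc hρ _ σ
  set U := (hσ.1.eigenvectorUnitary : Matrix n n ℂ) with hU
  set w : n → ℝ := fun i => ((star U * R ^ (k + 2) * U) i i).re with hw
  have hw0 : ∀ i, 0 ≤ w i := fun i => by
    have := ((hRpos.pow (k + 2)).conjTranspose_mul_mul_same U).diag_nonneg (i := i)
    exact (Complex.nonneg_iff.mp this).1
  have hUU : U * star U = 1 := Unitary.mul_star_self_of_mem hσ.1.eigenvectorUnitary.2
  have hsum : (R ^ (k + 2)).trace.re = ∑ i, w i := by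
    have e : (R ^ (k + 2)).trace = (star U * R ^ (k + 2) * U).trace := by
      rw [trace_mul_comm, ← Matrix.mul_assoc, hUU, Matrix.one_mul]
    rw [e, trace, Complex.re_sum]
    rfl
  calc _ ≤ ∫⁻ t in Set.Ioi (0 : ℝ), ∑ i, ENNReal.ofReal (w i) * ENNReal.ofReal ((k + 1) *
      (hσ.1.eigenvalues i ^ (k + 1) / (hσ.1.eigenvalues i + t) ^ (k + 2))) := by
        refine setLIntegral_mono' measurableSet_Ioi fun t ht => ?_
        have ht' : (0 : ℝ) < t := ht
        have hx := hσ.eigenvalues_nonneg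
        have hle := trace_shiftedSandwich_pow_le hρ hσ h k hp ht'
        rw [trace_mul_cfc hσ.1, Complex.re_sum] at hle
        simp only [Complex.re_mul_ofReal] at hle
        simp only [← ENNReal.ofReal_mul (hw0 _)]
        rw [← ENNReal.ofReal_sum_of_nonneg]
        · refine ENNReal.ofReal_le_ofReal ?_
          refine (mul_le_mul_of_nonneg_left hle (by positivity)).trans (le_of_eq ?_)
          rw [Finset.mul_sum]
          exact Finset.sum_congr rfl fun i _ => mul_left_comm _ _ _
        · intro i _
          have := hx i
          have := hw0 i
          positivity
    _ = ∑ i, ENNReal.ofReal (w i) * ∫⁻ t in Set.Ioi (0 : ℝ), ENNReal.ofReal ((k + 1) *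
      (hσ.1.eigenvalues i ^ (k + 1) / (hσ.1.eigenvalues i + t) ^ (k + 2))) := by
        rw [lintegral_finsetSum]
        · exact Finset.sum_congr rfl fun i _ => lintegral_const_mul _ (by fun_prop)
        · fun_prop
    _ ≤ ∑ i, ENNReal.ofReal (w i) * 1 := by
        gcongr with i
        exact lintegral_Ioi_pow_div_add_pow_le (hσ.eigenvalues_nonneg i) k
    _ = _ := by
        simp only [mul_one]
        rw [hsum, ENNReal.ofReal_sum_of_nonneg fun i _ => hw0 i]

/-! ### The Hellinger divergence of integer order -/

lemma deriv_deriv_hellingerFun (k : ℕ) :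
    deriv (deriv (hellingerFun ((k + 2 : ℕ) : ℝ))) = fun x : ℝ => (k + 2) * x ^ k := by
  have h0 : hellingerFun ((k + 2 : ℕ) : ℝ) = fun x : ℝ => (x ^ (k + 2) - 1) / (k + 1) := by
    ext x
    rw [hellingerFun, Real.rpow_natCast]
    push_cast
    ring
  have hk : (k + 1 : ℝ) ≠ 0 := by positivity
  have h1 : deriv (hellingerFun ((k + 2 : ℕ) : ℝ)) =
      fun x : ℝ => ((k + 2) / (k + 1)) * x ^ (k + 1) := by
    ext x
    rw [h0, deriv_div_const, deriv_sub_const, deriv_pow_field]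
    push_cast
    ring
  ext x
  rw [h1, deriv_const_mul_field, deriv_pow_field]
  push_cast
  field_simp

lemma hockeyStick_nonneg {ρ σ : Matrix n n ℂ} (hρ : ρ.IsHermitian) (hσ : σ.IsHermitian)
    (s : ℝ) : 0 ≤ hockeyStick s ρ σ := by
  rw [hockeyStick, tracePosPart, trace_cfc_re (isHermitian_sub_smul hρ hσ s)]
  exact Finset.sum_nonneg fun i _ => le_max_right _ _

lemma continuous_hockeyStick {ρ σ : Matrix n n ℂ} (hρ : ρ.IsHermitian) (hσ : σ.IsHermitian) :
    Continuous fun s => hockeyStick s ρ σ :=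
  continuous_trace_cfc (by fun_prop) (by fun_prop) fun s => isHermitian_sub_smul hρ hσ s

/-- With `X = ρ - s σ`, the left side is the trace of the negative part of `X`, that is `Tr X₊ - Tr
X`, and `Tr X = 1 - s`. -/
lemma hockeyStick_swap {ρ σ : Matrix n n ℂ} (hρ : IsState ρ) (hσ : IsState σ) {s : ℝ}
    (hs : 0 < s) : s * hockeyStick s⁻¹ σ ρ = hockeyStick s ρ σ - 1 + s := by
  set X := ρ - (s : ℂ) • σ with hX
  have hXh : X.IsHermitian := isHermitian_sub_smul hρ.1.1 hσ.1.1 s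
  have hXs : IsSelfAdjoint X := hXh
  have htr : X.trace.re = 1 - s := by
    rw [hX, trace_sub, trace_smul, hρ.2, hσ.2]
    simp
  have hsc : (s : ℂ) ≠ 0 := by exact_mod_cast hs.ne'
  have e : σ - ((s⁻¹ : ℝ) : ℂ) • ρ = cfc (fun x : ℝ => -s⁻¹ * x) X := by
    rw [cfc_const_mul_id (-s⁻¹) X, hX, neg_smul, smul_sub, ← Complex.coe_smul, ← Complex.coe_smul,
      smul_smul, Complex.ofReal_inv, inv_mul_cancel₀ hsc, one_smul, neg_sub]
  have h1 : hockeyStick s⁻¹ σ ρ = ∑ i, max (-s⁻¹ * hXh.eigenvalues i) 0 := by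
    rw [hockeyStick, tracePosPart, e, ← cfc_comp' (fun x : ℝ => max x 0) (fun x => -s⁻¹ * x) X
      (by fun_prop) (by fun_prop), trace_cfc_re hXh]
  have h2 : hockeyStick s ρ σ = ∑ i, max (hXh.eigenvalues i) 0 := trace_cfc_re hXh _
  have h3 : X.trace.re = ∑ i, hXh.eigenvalues i := by
    conv_lhs => rw [← cfc_id' ℝ X]
    exact trace_cfc_re hXh _
  have h4 : hockeyStick s ρ σ - 1 + s = hockeyStick s ρ σ - X.trace.re := by rw [htr]; ring
  rw [h4, h1, h2, h3, ← Finset.sum_sub_distrib, Finset.mul_sum]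
  refine Finset.sum_congr rfl fun i _ => ?_
  rw [← mul_max_of_nonneg _ _ hs.le |>.symm, mul_zero, ← mul_assoc, mul_neg,
    mul_inv_cancel₀ hs.ne', neg_one_mul]
  rcases le_total (hXh.eigenvalues i) 0 with h | h
  · rw [max_eq_right h, max_eq_left (by linarith)]; ring
  · rw [max_eq_left h, max_eq_right (by linarith)]; ring

lemma lintegral_Ioi_one_comp_inv (g : ℝ → ENNReal) :
    ∫⁻ x in Set.Ioi (1 : ℝ), ENNReal.ofReal (x ^ 2)⁻¹ * g x⁻¹ = ∫⁻ s in Set.Ioo (0 : ℝ) 1, g s := by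
  have himg : (fun x : ℝ => x⁻¹) '' Set.Ioi 1 = Set.Ioo 0 1 := by
    ext s
    constructor
    · rintro ⟨x, hx, rfl⟩
      have hx' : (1 : ℝ) < x := hx
      exact ⟨by simp only; positivity, inv_lt_one_of_one_lt₀ hx'⟩
    · rintro ⟨h0, h1⟩
      exact ⟨s⁻¹, (one_lt_inv₀ h0).mpr h1, inv_inv s⟩
  rw [← himg, lintegral_image_eq_lintegral_abs_deriv_mul measurableSet_Ioi
    (f' := fun x => -(x ^ 2)⁻¹)
    (fun x hx => (hasDerivAt_inv (by have : (1 : ℝ) < x := hx; positivity)).hasDerivWithinAt)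
    (inv_injective.injOn)]
  refine lintegral_congr fun x => ?_
  rw [abs_neg, abs_of_nonneg (by positivity)]

/-- Accounts for the `1` in `1 + (α-1) H_α`: it cancels the correction `-1 + s` on `(0, 1)`. -/
lemma lintegral_Ioo_pow_mul_one_sub (k : ℕ) :
    ∫⁻ s in Set.Ioo (0 : ℝ) 1, ENNReal.ofReal ((k + 1 + 1) * (k + 1) * s ^ k * (1 - s)) = 1 := by
  rw [restrict_Ioo_eq_restrict_Ioc, ← ofReal_integral_eq_lintegral_ofReal,
    ← intervalIntegral.integral_of_le zero_le_one]
  · have : ∀ s : ℝ, (k + 1 + 1) * (k + 1) * s ^ k * (1 - s) =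
        (k + 1 + 1) * (k + 1) * (s ^ k - s ^ (k + 1)) := fun s => by ring
    simp only [this]
    rw [intervalIntegral.integral_const_mul, intervalIntegral.integral_sub
      ((continuous_pow _).intervalIntegrable _ _) ((continuous_pow _).intervalIntegrable _ _),
      integral_pow, integral_pow]
    rw [← ENNReal.ofReal_one]
    congr 1
    push_cast
    field_simp
    simp
  · exact (Continuous.integrableOn_Icc (by fun_prop)).mono_set Set.Ioc_subset_Icc_self
  · rw [Filter.EventuallyLE, ae_restrict_iff' measurableSet_Ioc]
    refine Filter.Eventually.of_forall fun s hs => ?_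
    have h0 := hs.1.le
    have h1 : 0 ≤ 1 - s := sub_nonneg.mpr hs.2
    simp only [Pi.zero_apply]
    positivity

theorem one_add_mul_hellinger {ρ σ : Matrix n n ℂ} (hρ : IsState ρ) (hσ : IsState σ) (k : ℕ) :
    1 + ENNReal.ofReal (k + 1) * hellinger ((k + 2 : ℕ) : ℝ) ρ σ =
      ∫⁻ s in Set.Ioi (0 : ℝ), ENNReal.ofReal ((k + 1 + 1) * (k + 1) * s ^ k) *
        ENNReal.ofReal (hockeyStick s ρ σ) := by
  have hc := continuous_hockeyStick hρ.1.1 hσ.1.1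
  have hnn := hockeyStick_nonneg hρ.1.1 hσ.1.1
  have hnn' := hockeyStick_nonneg hσ.1.1 hρ.1.1
  set g : ℝ → ENNReal := fun s => ENNReal.ofReal ((k + 2) * s ^ k * (hockeyStick s ρ σ - 1 + s))
    with hg
  have split : hellinger ((k + 2 : ℕ) : ℝ) ρ σ =
      (∫⁻ s in Set.Ioi (1 : ℝ), ENNReal.ofReal ((k + 2) * s ^ k * hockeyStick s ρ σ)) +
        ∫⁻ s in Set.Ioo (0 : ℝ) 1, g s := by
    rw [← lintegral_Ioi_one_comp_inv, ← lintegral_add_left (by fun_prop), hellinger, fDivergence]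
    refine setLIntegral_congr_fun measurableSet_Ioi fun x hx => ?_
    have hx' : (1 : ℝ) < x := hx
    have hx0 : 0 < x := zero_lt_one.trans hx'
    simp only [deriv_deriv_hellingerFun]
    have h1 := hnn x
    have h2 := hnn' x
    rw [ENNReal.ofReal_add (by positivity) (by positivity), hg,
      ← ENNReal.ofReal_mul (by positivity), ← hockeyStick_swap hρ hσ (inv_pos.mpr hx0), inv_inv]
    congr 2
    field_simp
  have hIoi : Set.Ioi (0 : ℝ) = Set.Ioo 0 1 ∪ Set.Ici 1 :=
    (Set.Ioo_union_Ici_eq_Ioi zero_lt_one).symm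
  rw [hIoi, lintegral_union measurableSet_Ici
    (Set.disjoint_left.mpr fun x hx hx' => (hx.2.trans_le hx').false),
    setLIntegral_congr Ioi_ae_eq_Ici.symm, split, mul_add, ← lintegral_const_mul' _ _ ENNReal.ofReal_ne_top,
    ← lintegral_const_mul' _ _ ENNReal.ofReal_ne_top, add_left_comm, add_comm]
  congr 1
  · rw [← lintegral_Ioo_pow_mul_one_sub k, ← lintegral_add_left (by fun_prop)]
    refine setLIntegral_congr_fun measurableSet_Ioo fun s hs => ?_
    have h0 : 0 < s := hs.1
    have h1 : 0 ≤ 1 - s := sub_nonneg.mpr hs.2.le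
    have h2 : 0 ≤ hockeyStick s ρ σ - 1 + s := by
      rw [← hockeyStick_swap hρ hσ h0]
      exact mul_nonneg h0.le (hnn' _)
    simp only [hg]
    rw [← ENNReal.ofReal_mul (by positivity), ← ENNReal.ofReal_mul (by positivity),
      ← ENNReal.ofReal_add (by positivity) (by positivity)]
    congr 1
    ring
  · refine setLIntegral_congr_fun measurableSet_Ioi fun s hs => ?_
    have hs' : (1 : ℝ) < s := hs
    rw [← ENNReal.ofReal_mul (by positivity), ← ENNReal.ofReal_mul (by positivity)]
    congr 1
    ring

lemma opPow_natCast {X : Matrix n n ℂ} (hX : X.IsHermitian) (m : ℕ) : opPow X m = X ^ m := by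
  have hX' : IsSelfAdjoint X := hX
  rw [opPow, ← cfc_pow_id (R := ℝ) X m]
  simp only [Real.rpow_natCast]

theorem one_add_mul_hellinger_le_sandwichedTrace {ρ σ : Matrix n n ℂ} (hρ : IsState ρ)
    (hσ : IsState σ) (k : ℕ) :
    1 + ENNReal.ofReal (k + 1) * hellinger ((k + 2 : ℕ) : ℝ) ρ σ ≤
      sandwichedTrace ((k + 2 : ℕ) : ℝ) ρ σ := by
  rw [sandwichedTrace]
  split_ifs with h
  · exact le_top
  have hlt : (1 : ℝ) < ((k + 2 : ℕ) : ℝ) := by exact_mod_cast (by omega : 1 < k + 2)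
  have hs : SuppLE ρ σ := by
    by_contra hn
    exact h ⟨hlt, hn⟩
  set p : ℝ := (1 - ((k + 2 : ℕ) : ℝ)) / (2 * ((k + 2 : ℕ) : ℝ)) with hp
  have hR : (opPow σ p * ρ * opPow σ p).PosSemidef := posSemidef_cfc_mul_mul_cfc hρ.1 _ σ
  rw [one_add_mul_hellinger hρ hσ, lintegral_pow_mul_hockeyStick hρ.1 hσ.1,
    opPow_natCast hR.1]
  refine lintegral_trace_shiftedSandwich_pow_le hρ.1 hσ.1 hs k ?_
  rw [hp]
  push_cast
  rw [← neg_div]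
  congr 1
  ring

end QuantumDivergence

end

/-! ### Passage to extended-real divergences -/

theorem mainTheorem5 {n : Type*} [Fintype n] [DecidableEq n] (ρ σ : Matrix n n ℂ)
    (hρ : QuantumDivergence.IsState ρ) (hσ : QuantumDivergence.IsState σ)
    (α : ℕ) (hα : 2 ≤ α) :
    (QuantumDivergence.hellinger (α : ℝ) ρ σ : EReal)
        ≤ QuantumDivergence.sandwichedHellinger (α : ℝ) ρ σ ∧
      QuantumDivergence.renyi (α : ℝ) ρ σ
        ≤ QuantumDivergence.sandwichedRenyi (α : ℝ) ρ σ := by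
  obtain ⟨k, rfl⟩ := Nat.exists_eq_add_of_le' hα
  have key := QuantumDivergence.one_add_mul_hellinger_le_sandwichedTrace hρ hσ k
  rw [QuantumDivergence.renyi, QuantumDivergence.sandwichedHellinger,
    QuantumDivergence.sandwichedRenyi]
  have e1 : ((k + 2 : ℕ) : ℝ) - 1 = k + 1 := by push_cast; ring
  have e2 : 1 - ((k + 2 : ℕ) : ℝ) = -(k + 1) := by push_cast; ring
  rw [e1, e2]
  generalize QuantumDivergence.hellinger ((k + 2 : ℕ) : ℝ) ρ σ = H at key ⊢
  generalize QuantumDivergence.sandwichedTrace ((k + 2 : ℕ) : ℝ) ρ σ = Q at key ⊢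
  have hk : (0 : ℝ) < k + 1 := by positivity
  constructor
  · by_cases hQ : Q = ⊤
    -- The coefficient `1 / (1 - α)` is negative, so the right side is `⊤`.
    · rw [hQ, EReal.coe_ennreal_top, show (1 : EReal) - ⊤ = ⊥ from rfl, EReal.coe_mul_bot_of_neg
        (by rw [one_div_neg_eq_neg_one_div, neg_lt_zero]; positivity)]
      exact le_top
    · have hH : H ≠ ⊤ := by
        rintro rfl
        rw [ENNReal.mul_top (by simpa using hk), add_top, top_le_iff] at key
        exact hQ key
      lift Q to NNReal using hQ
      lift H to NNReal using hH
      have key' : 1 + (k + 1) * (H : ℝ) ≤ Q := by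
        have := ENNReal.toReal_mono ENNReal.coe_ne_top key
        rw [ENNReal.toReal_add ENNReal.one_ne_top
          (ENNReal.mul_ne_top ENNReal.ofReal_ne_top ENNReal.coe_ne_top), ENNReal.toReal_mul,
          ENNReal.toReal_ofReal hk.le] at this
        simpa using this
      have : (H : ℝ) ≤ 1 / -(k + 1) * (1 - Q) := by
        rw [one_div, inv_neg, neg_mul, ← mul_neg, neg_sub, ← div_eq_inv_mul, le_div_iff₀ hk]
        linarith
      have hE := EReal.coe_le_coe this
      rwa [EReal.coe_mul, EReal.coe_sub, EReal.coe_one] at hE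
  · refine mul_le_mul_of_nonneg_left (ENNReal.log_monotone ?_)
      (by exact_mod_cast (by positivity : (0 : ℝ) ≤ 1 / (k + 1)))
    have : (1 : EReal) + ((k + 1 : ℝ) : EReal) * (H : EReal) =
        ((1 + ENNReal.ofReal (k + 1) * H : ENNReal) : EReal) := by
      rw [EReal.coe_ennreal_add, EReal.coe_ennreal_mul, EReal.coe_ennreal_ofReal,
        max_eq_left hk.le, EReal.coe_ennreal_one]
    rwa [this, EReal.toENNReal_coe]
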